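/- Let $n,d$ be positive integers and identify $\mathbb R^{2n+3}\cong\mathbb R^3\times\mathbb C^n$ via $z_k=x_{2k+2}+i\,x_{2k+3}$ ($k=1,\dots,n$). Let $p:\mathbb R^3\to\mathbb C$ be a complex-valued homogeneous polynomial of degree $2$ which is harmonic and horizontally conformal, i.e. $$\sum_{k=1}^3\frac{\partial^2p}{\partial x_k^2}=0\quad\text{and}\quad \sum_{k=1}^3\Big(\frac{\partial p}{\partial x_k}\Big)^2=0,$$ and let $P_d,Q_d$ be homogeneous polynomials of degree $d$ in the complex variables $z_1,\dots,z_n$. Set $$\hat\Phi_d(x,z)=\frac{p(x)^{d/2}+P_d(z)}{Q_d(z)},$$ where, for odd $d$, $p^{d/2}=(\sqrt p)^d$ with $\sqrt{\ }$ the principal branch of the square root on $\mathbb C\setminus(-\infty,0]$. Let $\hat U_d\subset\mathbb R^3\times\mathbb C^n$ be the set of all $(x,z)$ with $Q_d(z)\neq0$ and, if $d$ is odd, also $p(x)\notin(-\infty,0]$. Let $S^{2n+2}$ be the unit sphere of $\mathbb R^{2n+3}$ with its round metric, $\pi:\mathbb R^{2n+3}\setminus\{0\}\to S^{2n+2}$,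 $\pi(y)=y/|y|$, the radial projection. Then $0\notin\hat U_d$; the set $\hat U_d$ and the map $\hat\Phi_d$ are invariant under $y\mapsto\lambda y$ for every real $\lambda>0$; the set $U_d=\pi(\hat U_d)$ is open in $S^{2n+2}$; and there is a (necessarily unique) map $\Phi_d:U_d\to\mathbb C$ with $\Phi_d\circ\pi=\hat\Phi_d$ on $\hat U_d$. This map $\Phi_d$ is smooth and is a harmonic morphism: for every harmonic function $f:W\to\mathbb R$ on an open set $W\subset\mathbb C$, the composition $f\circ\Phi_d$ is a harmonic function (with respect to the Laplace-Beltrami operator of the round metric) on $\Phi_d^{-1}(W)\subset S^{2n+2}$. -/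

import Mathlib

open scoped Manifold ContDiff

noncomputable section

namespace SphereHM

/-! ### Riemannian Laplacian and harmonic morphisms into `ℂ` -/

section Riemannian

variable {m : ℕ} {M : Type*} [TopologicalSpace M] [ChartedSpace (EuclideanSpace ℝ (Fin m)) M]

/-- A field of bilinear forms on the tangent spaces of an `m`-dimensional manifold. -/
abbrev TensorField (m : ℕ) (M : Type*) [TopologicalSpace M]
    [ChartedSpace (EuclideanSpace ℝ (Fin m)) M] : Type _ :=
  (x : M) → LinearMap.BilinForm ℝ (TangentSpace (𝓡 m) x)

/-- The coordinate vector field `∂/∂uᵢ` of the preferred chart at `x₀`, at the point with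
coordinates `u`. -/
def coordVector (x₀ : M) (i : Fin m) (u : EuclideanSpace ℝ (Fin m)) :
    TangentSpace (𝓡 m) ((extChartAt (𝓡 m) x₀).symm u) :=
  mfderiv (𝓡 m) (𝓡 m) (extChartAt (𝓡 m) x₀).symm u (EuclideanSpace.single i (1 : ℝ))

/-- The matrix `gᵢⱼ(u) = g(∂/∂uᵢ, ∂/∂uⱼ)` in the preferred chart at `x₀`. -/
def metricMatrix (g : TensorField m M) (x₀ : M) (u : EuclideanSpace ℝ (Fin m)) :
    Matrix (Fin m) (Fin m) ℝ :=
  Matrix.of fun i j =>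
    g ((extChartAt (𝓡 m) x₀).symm u) (coordVector x₀ i u) (coordVector x₀ j u)

/-- The Laplace-Beltrami operator
`Δ f = |g|^(-1/2) ∑ᵢ ∂ᵢ (|g|^(1/2) ∑ⱼ gⁱʲ ∂ⱼ f)`, computed at `x₀` in the preferred chart
at `x₀`. -/
def laplaceBeltrami (g : TensorField m M) (f : M → ℝ) (x₀ : M) : ℝ :=
  (√(metricMatrix g x₀ (extChartAt (𝓡 m) x₀ x₀)).det)⁻¹ *
    ∑ i : Fin m,
      fderiv ℝ
        (fun u : EuclideanSpace ℝ (Fin m) =>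
          √(metricMatrix g x₀ u).det *
            ∑ j : Fin m, (metricMatrix g x₀ u)⁻¹ i j *
              fderiv ℝ (f ∘ (extChartAt (𝓡 m) x₀).symm) u (EuclideanSpace.single j 1))
        (extChartAt (𝓡 m) x₀ x₀) (EuclideanSpace.single i 1)

/-- `f` is a harmonic function on the open subset `V` of `(M, g)`. -/
def IsHarmonicOn (g : TensorField m M) (f : M → ℝ) (V : Set M) : Prop :=
  ContMDiffOn (𝓡 m) 𝓘(ℝ, ℝ) 2 f V ∧ ∀ x ∈ V, laplaceBeltrami g f x = 0

/-- The smooth map `φ : V → ℂ`, defined on the open subset `V` of `(M, g)`, is a harmonic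
morphism: it pulls back harmonic functions, defined on open subsets `W` of `ℂ`, to harmonic
functions. -/
def IsHarmonicMorphismOn (g : TensorField m M) (φ : M → ℂ) (V : Set M) : Prop :=
  ContMDiffOn (𝓡 m) 𝓘(ℝ, ℂ) ∞ φ V ∧
    ∀ (W : Set ℂ) (f : ℂ → ℝ), IsOpen W → InnerProductSpace.HarmonicOnNhd f W →
      IsHarmonicOn g (f ∘ φ) (V ∩ φ ⁻¹' W)

end Riemannian

/-! ### The round sphere -/

/-- The unit sphere of dimension `m` in `ℝ^(m+1)`. -/
abbrev Sphere (m : ℕ) : Type := Metric.sphere (0 : EuclideanSpace ℝ (Fin (m + 1))) 1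

/-- The differential of the inclusion of the sphere in Euclidean space. -/
def inclDeriv (m : ℕ) (x : Sphere m) :
    TangentSpace (𝓡 m) x →L[ℝ] EuclideanSpace ℝ (Fin (m + 1)) :=
  mfderiv (𝓡 m) 𝓘(ℝ, EuclideanSpace ℝ (Fin (m + 1)))
    (fun y : Sphere m => (y : EuclideanSpace ℝ (Fin (m + 1)))) x

/-- The round metric: the metric induced from Euclidean space. -/
def roundMetric (m : ℕ) : TensorField m (Sphere m) := fun x =>
  (innerₗ (EuclideanSpace ℝ (Fin (m + 1)))).compl₁₂
    (inclDeriv m x).toLinearMap (inclDeriv m x).toLinearMap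

/-- The radial projection `x ↦ x / |x|` of `ℝ^(m+1) ∖ {0}` onto the sphere. -/
def radialProj (m : ℕ) (x : {x : EuclideanSpace ℝ (Fin (m + 1)) // x ≠ 0}) : Sphere m :=
  ⟨‖x.1‖⁻¹ • x.1, by
    rw [mem_sphere_zero_iff_norm, norm_smul, norm_inv, norm_norm,
      inv_mul_cancel₀ (norm_ne_zero_iff.2 x.2)]⟩

/-! ### The maps on `ℝ³ × ℂⁿ` -/

/-- `p` is a (complex-valued) harmonic homogeneous polynomial of degree two on `ℝ³` which is
horizontally conformal: `τ(p) = ∑ ∂²p/∂xₖ² = 0` and `κ(p, p) = ∑ (∂p/∂xₖ)² = 0`. -/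
structure IsConformalHarmonicQuadratic (p : MvPolynomial (Fin 3) ℂ) : Prop where
  homogeneous : p.IsHomogeneous 2
  harmonic : ∑ k, MvPolynomial.pderiv k (MvPolynomial.pderiv k p) = 0
  conformal : ∑ k, MvPolynomial.pderiv k p * MvPolynomial.pderiv k p = 0

variable (n d : ℕ) (p : MvPolynomial (Fin 3) ℂ) (P Q : MvPolynomial (Fin n) ℂ)

/-- The identification `ℝ^(2n+3) ≅ ℝ³ × ℂⁿ`, first component: the (zero-based) coordinates
`0, 1, 2`, as complex numbers. -/
def realPart (x : EuclideanSpace ℝ (Fin (2 * n + 2 + 1))) : Fin 3 → ℂ :=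
  fun k => (x ⟨k, by omega⟩ : ℂ)

/-- The identification `ℝ^(2n+3) ≅ ℝ³ × ℂⁿ`, second component: the `k`-th complex coordinate
is made of the (zero-based) real coordinates `2k+3` and `2k+4`. -/
def complexPart (x : EuclideanSpace ℝ (Fin (2 * n + 2 + 1))) : Fin n → ℂ :=
  fun k => (x ⟨2 * k + 3, by omega⟩ : ℂ) + (x ⟨2 * k + 4, by omega⟩ : ℂ) * Complex.I

/-- `w^(d/2)`: a power of `w` for even `d`, a power of the principal square root of `w` for
odd `d`. -/
def halfPow (w : ℂ) : ℂ :=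
  if Even d then w ^ (d / 2) else (w ^ (1 / 2 : ℂ)) ^ d

/-- The domain of `(p^(d/2) + P) / Q`: the points `(x, z)` with `Q(z) ≠ 0` and, for odd `d`,
with `p(x)` not in `(-∞, 0]`. -/
def hatDomain : Set (EuclideanSpace ℝ (Fin (2 * n + 2 + 1))) :=
  {x | MvPolynomial.eval (complexPart n x) Q ≠ 0 ∧
    (Odd d → MvPolynomial.eval (realPart n x) p ∈ Complex.slitPlane)}

/-- The function `(x, z) ↦ (p(x)^(d/2) + P(z)) / Q(z)`. -/
def hatPhi (x : EuclideanSpace ℝ (Fin (2 * n + 2 + 1))) : ℂ :=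
  (halfPow d (MvPolynomial.eval (realPart n x) p) + MvPolynomial.eval (complexPart n x) P) /
    MvPolynomial.eval (complexPart n x) Q

/-- The image of the domain under the radial projection, a subset of `S^(2n+2)`. -/
def sphereDomain : Set (Sphere (2 * n + 2)) :=
  radialProj (2 * n + 2) '' {x | x.1 ∈ hatDomain n d p Q}

/-- `Φ` is induced on the sphere by `(p^(d/2) + P) / Q`, that is `Φ ∘ π = (p^(d/2) + P) / Q`
on the domain of the latter. (The values of `Φ` outside `sphereDomain` play no role.) -/
def IsInducedMap (Φ : Sphere (2 * n + 2) → ℂ) : Prop :=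
  ∀ x : {x : EuclideanSpace ℝ (Fin (2 * n + 2 + 1)) // x ≠ 0}, x.1 ∈ hatDomain n d p Q →
    Φ (radialProj (2 * n + 2) x) = hatPhi n d p P Q x.1

end SphereHM

end

open scoped Manifold ContDiff
open Topology

/-! The numerator and denominator of `hatPhi` scale by the same factor `t ^ d` under `y ↦ t • y`
with `t > 0`, so `hatPhi` is homogeneous of degree zero on an open cone and descends to the sphere.
On the unit sphere the Laplace-Beltrami operator of a function equals the Euclidean Laplacian of its
degree-zero extension (`laplaceBeltrami_roundMetric_eq_laplacian`), so everything reduces to showing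
that `f ∘ hatPhi` is harmonic on the cone in Euclidean space.

Near a given value, a harmonic `f` is the real part of a holomorphic `F`, so it suffices that `F ∘
hatPhi` has zero Laplacian (`laplacian_comp_hatPhi_eq_zero`). In the three real directions it has
the form `a ∘ p` with `a` holomorphic, and its second derivatives add up to `a''(p) ∑ (∂ₖp)² + a'(p)
∑ ∂ₖ²p`, where both sums vanish by hypothesis. In each complex coordinate it is holomorphic, so the
two real second derivatives are `β''` and `i² β''`, and they cancel. -/

namespace SphereHM

/-! ### Stereographic charts and the Laplace-Beltrami operator at their centre. -/

/-- The inverse of the preferred chart at `x₀` is the inverse stereographic projection from `-x₀`,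
after a linear isometry `L` onto the tangent hyperplane at `x₀`. -/
theorem exists_linearIsometry_extChartAt_symm {m : ℕ} (x₀ : Sphere m) :
    ∃ L : EuclideanSpace ℝ (Fin m) →ₗᵢ[ℝ] EuclideanSpace ℝ (Fin (m + 1)),
      (∀ u, inner ℝ (x₀ : EuclideanSpace ℝ (Fin (m + 1))) (L u) = 0) ∧
      ∀ u, (((extChartAt (𝓡 m) x₀).symm u : Sphere m) : EuclideanSpace ℝ (Fin (m + 1))) =
        (‖u‖ ^ 2 + 4)⁻¹ • ((4 : ℝ) • L u + (4 - ‖u‖ ^ 2) • (x₀ : EuclideanSpace ℝ (Fin (m + 1))))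
            := by
  have := Fact.mk (@finrank_euclideanSpace_fin ℝ _ (m + 1))
  let U := (OrthonormalBasis.fromOrthogonalSpanSingleton (𝕜 := ℝ) m
    (ne_zero_of_mem_unit_sphere (-x₀))).repr
  refine ⟨(Submodule.subtypeₗᵢ _).comp U.symm.toLinearIsometry, fun u => ?_, fun u => ?_⟩
  · have h := (U.symm u).2
    rw [Submodule.mem_orthogonal_singleton_iff_inner_right] at h
    simp only [coe_neg_sphere, inner_neg_left, neg_eq_zero] at h
    exact h
  · have h := stereographic'_symm_apply (-x₀) u
    have hu : ‖((U.symm u : _) : EuclideanSpace ℝ (Fin (m + 1)))‖ = ‖u‖ := by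
      exact U.symm.norm_map u
    change ((stereographic' m (-x₀)).symm u : EuclideanSpace ℝ (Fin (m + 1))) = _
    rw [h]
    change (‖((U.symm u : _) : EuclideanSpace ℝ (Fin (m + 1)))‖ ^ 2 + 4)⁻¹ • (4 : ℝ) • _ +
        (‖((U.symm u : _) : EuclideanSpace ℝ (Fin (m + 1)))‖ ^ 2 + 4)⁻¹ •
        (‖((U.symm u : _) : EuclideanSpace ℝ (Fin (m + 1)))‖ ^ 2 - 4) •
        (-(x₀ : EuclideanSpace ℝ (Fin (m + 1)))) = (_ : ℝ) •
        ((4 : ℝ) • ((U.symm u : _) : EuclideanSpace ℝ (Fin (m + 1))) + _)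
    rw [hu]
    module

theorem extChartAt_self_eq_zero {m : ℕ} (x₀ : Sphere m) : extChartAt (𝓡 m) x₀ x₀ = 0 := by
  have := Fact.mk (@finrank_euclideanSpace_fin ℝ _ (m + 1))
  let U := (OrthonormalBasis.fromOrthogonalSpanSingleton (𝕜 := ℝ) m
    (ne_zero_of_mem_unit_sphere (-x₀))).repr
  change U (stereographic (norm_eq_of_mem_sphere (-x₀)) x₀) = 0
  rw [stereographic_neg_apply]
  exact U.map_zero

/-- The inverse stereographic projection centred at `x`, precomposed with the isometry `L`. -/
noncomputable def stereoParam {E F : Type*} [NormedAddCommGroup E] [InnerProductSpace ℝ E]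
    [NormedAddCommGroup F] [InnerProductSpace ℝ F] (L : E →ₗᵢ[ℝ] F) (x : F) (u : E) : F :=
  (‖u‖ ^ 2 + 4)⁻¹ • ((4 : ℝ) • L u + (4 - ‖u‖ ^ 2) • x)

section
variable {E F : Type*} [NormedAddCommGroup E] [InnerProductSpace ℝ E]
    [NormedAddCommGroup F] [InnerProductSpace ℝ F]

theorem contDiff_stereoParam (L : E →ₗᵢ[ℝ] F) (x : F) {k : ℕ∞ω} :
    ContDiff ℝ k (stereoParam L x) := by
  have h₀ : ContDiff ℝ k fun w : E => ‖w‖ ^ 2 := contDiff_norm_sq ℝ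
  have h₁ : ContDiff ℝ k fun w : E => (‖w‖ ^ 2 + 4)⁻¹ :=
    (h₀.add contDiff_const).inv fun w => by positivity
  exact h₁.smul ((contDiff_const.smul L.contDiff).add ((contDiff_const.sub h₀).smul contDiff_const))

theorem fderiv_stereoParam (L : E →ₗᵢ[ℝ] F) (x : F) (u v : E) :
    fderiv ℝ (stereoParam L x) u v = (4 * (‖u‖ ^ 2 + 4)⁻¹) • L v -
      (8 * (‖u‖ ^ 2 + 4)⁻¹ ^ 2 * inner ℝ u v) • L u -
      (16 * (‖u‖ ^ 2 + 4)⁻¹ ^ 2 * inner ℝ u v) • x := by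
  have h₀ : HasFDerivAt (fun w : E => ‖w‖ ^ 2) (2 • innerSL ℝ u) u :=
    (hasStrictFDerivAt_norm_sq u).hasFDerivAt
  have hD : ‖u‖ ^ 2 + 4 ≠ 0 := by positivity
  have h₁ := (hasDerivAt_inv hD).comp_hasFDerivAt u (h₀.add_const 4)
  have h₂ := (L.toContinuousLinearMap.hasFDerivAt (x := u)).const_smul (4 : ℝ)
  have h₃ := (h₀.const_sub 4).smul_const x
  have h := h₁.smul (h₂.add h₃)
  have : fderiv ℝ (stereoParam L x) u v = _ := congrArg (fun A => A v) h.fderiv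
  rw [this]
  simp
  match_scalars
  · field_simp
  · field_simp
    ring
  · field_simp
    ring

/-- This is the conformality of stereographic projection. With `D = ‖u‖² + 4`, the product
`⟨u,v⟩⟨u,w⟩` has coefficient `-64 D⁻³ + (64 ‖u‖² + 256) D⁻⁴ = 0`, so only the multiple of `⟨v,w⟩`
survives. -/
theorem inner_fderiv_stereoParam (L : E →ₗᵢ[ℝ] F) {x : F} (hx : ‖x‖ = 1)
    (hL : ∀ u, inner ℝ x (L u) = 0) (u v w : E) :
    inner ℝ (fderiv ℝ (stereoParam L x) u v) (fderiv ℝ (stereoParam L x) u w) =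
      (4 / (‖u‖ ^ 2 + 4)) ^ 2 * inner ℝ v w := by
  have hL' : ∀ u, inner ℝ (L u) x = 0 := fun u => by rw [real_inner_comm, hL]
  have hD : ‖u‖ ^ 2 + 4 ≠ 0 := by positivity
  simp only [fderiv_stereoParam, inner_sub_left, inner_sub_right, inner_smul_left, inner_smul_right,
    hL, hL', L.inner_map_map, real_inner_self_eq_norm_sq, hx]
  simp only [map_mul, map_pow, map_inv₀, conj_trivial, real_inner_comm u v]
  field_simp
  ring

end

theorem coe_extChartAt_symm_contDiff {m : ℕ} (x₀ : Sphere m) {k : ℕ∞ω} :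
    ContDiff ℝ k (fun u => (((extChartAt (𝓡 m) x₀).symm u : Sphere m) :
      EuclideanSpace ℝ (Fin (m + 1)))) := by
  obtain ⟨L, -, h⟩ := exists_linearIsometry_extChartAt_symm x₀
  rw [show (fun u => (((extChartAt (𝓡 m) x₀).symm u : Sphere m) :
      EuclideanSpace ℝ (Fin (m + 1)))) = stereoParam L x₀ from funext h]
  exact contDiff_stereoParam L _

theorem inclDeriv_coordVector {m : ℕ} (x₀ : Sphere m) (i : Fin m) (u : EuclideanSpace ℝ (Fin m)) :
    inclDeriv m ((extChartAt (𝓡 m) x₀).symm u) (coordVector x₀ i u) =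
      fderiv ℝ (fun u => (((extChartAt (𝓡 m) x₀).symm u : Sphere m) :
        EuclideanSpace ℝ (Fin (m + 1)))) u (EuclideanSpace.single i 1) := by
  have := Fact.mk (@finrank_euclideanSpace_fin ℝ _ (m + 1))
  -- The chart omits only the antipode of `x₀`, so its inverse is differentiable at every `u`.
  have ht : (extChartAt (𝓡 m) x₀).target = Set.univ := by
    simp [chartAt, ChartedSpace.chartAt, mfld_simps]
  have h1 : MDifferentiableAt (𝓡 m) (𝓡 m) (extChartAt (𝓡 m) x₀).symm u :=
    ((contMDiffOn_extChartAt_symm (n := 1) x₀).contMDiffAt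
        (by rw [ht]; exact Filter.univ_mem)).mdifferentiableAt one_ne_zero
  have h2 : MDifferentiableAt (𝓡 m) 𝓘(ℝ, EuclideanSpace ℝ (Fin (m + 1)))
    (fun y : Sphere m => (y : EuclideanSpace ℝ (Fin (m + 1)))) ((extChartAt (𝓡 m) x₀).symm u) :=
    contMDiff_coe_sphere.mdifferentiableAt one_ne_zero
  have h3 := mfderiv_comp u h2 h1
  rw [mfderiv_eq_fderiv] at h3
  exact (congrArg (fun A => A (EuclideanSpace.single i (1 : ℝ))) h3).symm

theorem metricMatrix_roundMetric {m : ℕ} (x₀ : Sphere m) (u : EuclideanSpace ℝ (Fin m)) :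
    metricMatrix (roundMetric m) x₀ u = ((4 / (‖u‖ ^ 2 + 4)) ^ 2) • (1 : Matrix (Fin m) (Fin m) ℝ)
        := by
  obtain ⟨L, hL, h⟩ := exists_linearIsometry_extChartAt_symm x₀
  ext i j
  have : metricMatrix (roundMetric m) x₀ u i j = inner ℝ
    (inclDeriv m ((extChartAt (𝓡 m) x₀).symm u) (coordVector x₀ i u))
    (inclDeriv m ((extChartAt (𝓡 m) x₀).symm u) (coordVector x₀ j u)) := rfl
  rw [this, inclDeriv_coordVector, inclDeriv_coordVector,
    show (fun u => (((extChartAt (𝓡 m) x₀).symm u : Sphere m) :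
      EuclideanSpace ℝ (Fin (m + 1)))) = stereoParam L x₀ from funext h,
    inner_fderiv_stereoParam L (by simp) hL]
  simp [EuclideanSpace.inner_single_left, Matrix.one_apply]

theorem fderiv_mul_apply_of_fderiv_eq_zero {E : Type*} [NormedAddCommGroup E] [NormedSpace ℝ E]
    {c k : E → ℝ} {x : E}
    (hc : HasFDerivAt c (0 : E →L[ℝ] ℝ) x) (hc1 : c x = 1) (hk : DifferentiableAt ℝ k x) :
    fderiv ℝ (fun y => c y * k y) x = fderiv ℝ k x := by
  refine (hc.mul hk.hasFDerivAt).fderiv.trans ?_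
  simp [hc1]

/-- The chart is conformal, with conformal factor of zero differential at the base point, so that
the Laplace-Beltrami operator is the coordinate Laplacian there. -/
theorem laplaceBeltrami_roundMetric {m : ℕ} (x₀ : Sphere m) (f : Sphere m → ℝ)
    (hf : ContDiffAt ℝ 2 (f ∘ (extChartAt (𝓡 m) x₀).symm) 0) :
    laplaceBeltrami (roundMetric m) f x₀ =
      ∑ i, fderiv ℝ (fun u => fderiv ℝ (f ∘ (extChartAt (𝓡 m) x₀).symm) u
          (EuclideanSpace.single i 1)) 0
        (EuclideanSpace.single i 1) := by
  set g := f ∘ (extChartAt (𝓡 m) x₀).symm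
  -- With `ρ = 4 / (‖u‖² + 4)`, `c` is `ρ ^ m * (ρ ^ 2)⁻¹`: the volume density times the inverse
  -- metric factor. The product form avoids the exponent `m - 2`, which would truncate for `m < 2`.
  -- Since `c` depends on `‖u‖²` alone, its differential vanishes at `0`.
  set c : EuclideanSpace ℝ (Fin m) → ℝ := fun u => √(metricMatrix (roundMetric m) x₀ u).det *
      ((4 / (‖u‖ ^ 2 + 4)) ^ 2)⁻¹ with hc
  have hc' : c = fun u => (4 / (‖u‖ ^ 2 + 4)) ^ m * ((4 / (‖u‖ ^ 2 + 4)) ^ 2)⁻¹ := by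
    funext u
    have : 0 ≤ (4 / (‖u‖ ^ 2 + 4)) ^ m := by positivity
    simp only [hc, metricMatrix_roundMetric, Matrix.det_smul, Matrix.det_one, Fintype.card_fin,
        mul_one]
    rw [← pow_mul, mul_comm 2 m, pow_mul, Real.sqrt_sq this]
  have hc1 : c 0 = 1 := by simp [hc']
  have hcd : HasFDerivAt c (0 : EuclideanSpace ℝ (Fin m) →L[ℝ] ℝ) 0 := by
    have h₀ : HasFDerivAt (fun w : EuclideanSpace ℝ (Fin m) => ‖w‖ ^ 2)
        (0 : EuclideanSpace ℝ (Fin m) →L[ℝ] ℝ) 0 := by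
      convert! (hasStrictFDerivAt_norm_sq (0 : EuclideanSpace ℝ (Fin m))).hasFDerivAt
      simp
    have h₁ : DifferentiableAt ℝ (fun s : ℝ => (4 / (s + 4)) ^ m * ((4 / (s + 4)) ^ 2)⁻¹)
        (‖(0 : EuclideanSpace ℝ (Fin m))‖ ^ 2) := by
      simp only [norm_zero]
      fun_prop (disch := norm_num)
    rw [hc']
    have h₂ := h₁.hasDerivAt.comp_hasFDerivAt 0 h₀
    rw [smul_zero] at h₂
    exact h₂
  have hm : ∀ u i, √(metricMatrix (roundMetric m) x₀ u).det *
      ∑ j : Fin m, (metricMatrix (roundMetric m) x₀ u)⁻¹ i j * fderiv ℝ g u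
          (EuclideanSpace.single j 1) =
      c u * fderiv ℝ g u (EuclideanSpace.single i 1) := by
    intro u i
    have hne : (4 / (‖u‖ ^ 2 + 4)) ^ 2 ≠ 0 := by positivity
    have : (metricMatrix (roundMetric m) x₀ u)⁻¹ = ((4 / (‖u‖ ^ 2 + 4)) ^ 2)⁻¹ • 1 := by
      apply Matrix.inv_eq_right_inv
      rw [metricMatrix_roundMetric]
      simp [smul_smul, hne]
    rw [this, hc]
    simp [Matrix.one_apply, mul_assoc]
  have h0 : √(metricMatrix (roundMetric m) x₀ 0).det = 1 := by
    simp [metricMatrix_roundMetric]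
  unfold laplaceBeltrami
  rw [extChartAt_self_eq_zero, h0, inv_one, one_mul]
  refine Finset.sum_congr rfl fun i _ => ?_
  refine (congrArg (fun k => fderiv ℝ k 0 (EuclideanSpace.single i 1))
    (funext fun u => hm u i)).trans ?_
  rw [fderiv_mul_apply_of_fderiv_eq_zero hcd hc1]
  exact ((hf.fderiv_right (m := 1) le_rfl).differentiableAt one_ne_zero).clm_apply
      (differentiableAt_const _)

/-! ### Second derivatives along curves, and comparison with the Euclidean Laplacian. -/

section
variable {E F : Type*} [NormedAddCommGroup E] [NormedSpace ℝ E]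
    [NormedAddCommGroup F] [NormedSpace ℝ F]

theorem fderiv_fderiv_apply_eq_deriv_deriv {g : E → F} {x : E} (hg : ContDiffAt ℝ 2 g x) (v : E) :
    fderiv ℝ (fun u => fderiv ℝ g u v) x v = deriv (deriv fun t : ℝ => g (x + t • v)) 0 := by
  have hl : ∀ t : ℝ, HasDerivAt (fun t : ℝ => x + t • v) v t := fun t => by
    simpa using ((hasDerivAt_id t).smul_const v).const_add x
  have hl0 : Filter.Tendsto (fun t : ℝ => x + t • v) (𝓝 0) (𝓝 x) := by
    simpa using (hl 0).continuousAt.tendsto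
  have hev : ∀ᶠ t : ℝ in 𝓝 0, deriv (fun t : ℝ => g (x + t • v)) t = fderiv ℝ g (x + t • v) v := by
    filter_upwards [hl0.eventually (hg.eventually (by simp))] with t ht
    exact ((ht.differentiableAt two_ne_zero).hasFDerivAt.comp_hasDerivAt t (hl t)).deriv
  rw [Filter.EventuallyEq.deriv_eq hev]
  have hd : DifferentiableAt ℝ (fun u => fderiv ℝ g u v) (x + (0 : ℝ) • v) := by
    rw [zero_smul, add_zero]
    exact ((hg.fderiv_right (m := 1) le_rfl).differentiableAt one_ne_zero).clm_apply
      (differentiableAt_const _)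
  have := (hd.hasFDerivAt.comp_hasDerivAt 0 (hl 0)).deriv
  rw [zero_smul, add_zero] at this
  exact this.symm

theorem laplacian_eq_sum_deriv_deriv {E : Type*} [NormedAddCommGroup E] [InnerProductSpace ℝ E]
    [FiniteDimensional ℝ E] {ι : Type*} [Fintype ι] (b : OrthonormalBasis ι ℝ E) {g : E → F}
        {x : E} (hg : ContDiffAt ℝ 2 g x) :
    Laplacian.laplacian g x = ∑ i, deriv (deriv fun t : ℝ => g (x + t • b i)) 0 := by
  rw [InnerProductSpace.laplacian_eq_iteratedFDeriv_orthonormalBasis g b]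
  refine Finset.sum_congr rfl fun i _ => ?_
  rw [← fderiv_fderiv_apply_eq_deriv_deriv hg, iteratedFDeriv_two_apply]
  have hd := (hg.fderiv_right (m := 1) le_rfl).differentiableAt one_ne_zero
  rw [fderiv_clm_apply hd (differentiableAt_const _)]
  simp

/-- In `(γ ∘ s)'' = γ''(s) s'² + γ'(s) s''` the reparametrization enters only through `s'(0) = 1`
and `s''(0) = 0`. It serves to replace coordinate lines of the chart by straight lines. -/
theorem deriv_deriv_comp_of_deriv_eq_one {γ : ℝ → F} (hγ : ContDiffAt ℝ 2 γ 0) {s k : ℝ → ℝ}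
    (hs0 : s 0 = 0)
    (hs : ∀ᶠ t in 𝓝 0, HasDerivAt s (k t) t) (hk : HasDerivAt k 0 0) (hk1 : k 0 = 1) :
    deriv (deriv fun t => γ (s t)) 0 = deriv (deriv γ) 0 := by
  have hst : Filter.Tendsto s (𝓝 0) (𝓝 0) := by
    simpa [ContinuousAt, hs0] using hs.self_of_nhds.continuousAt
  have hev : ∀ᶠ t in 𝓝 0, deriv (fun t => γ (s t)) t = k t • deriv γ (s t) := by
    filter_upwards [hs, hst.eventually (hγ.eventually (by simp))] with t ht ht'
    exact ((ht'.differentiableAt two_ne_zero).hasDerivAt.scomp t ht).deriv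
  rw [Filter.EventuallyEq.deriv_eq hev]
  have hd : DifferentiableAt ℝ (deriv γ) 0 := by
    have := ((hγ.fderiv_right (m := 1) le_rfl).differentiableAt one_ne_zero).clm_apply
      (differentiableAt_const (1 : ℝ))
    exact this
  have h1 : HasDerivAt (fun t => deriv γ (s t)) (deriv (deriv γ) 0) 0 := by
    have h := hs.self_of_nhds
    rw [hk1] at h
    have hd' := hd.hasDerivAt
    rw [← hs0] at hd'
    have h2 := hd'.scomp 0 h
    rw [hs0, one_smul] at h2
    exact h2
  have := (hk.smul h1).deriv
  simp only [hk1, one_smul, zero_smul, add_zero] at this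
  exact this

end

/-- The spherical Laplacian is the Euclidean Laplacian of the extension that is homogeneous of
degree zero. -/
theorem laplaceBeltrami_roundMetric_eq_laplacian {m : ℕ} (x₀ : Sphere m) (f : Sphere m → ℝ)
    (G : EuclideanSpace ℝ (Fin (m + 1)) → ℝ)
    (hG : ContDiffAt ℝ 2 G x₀) (hfG : ∀ᶠ y in 𝓝 x₀, f y = G y)
    (hhom : ∀ᶠ y in 𝓝 (x₀ : EuclideanSpace ℝ (Fin (m + 1))), ∀ t : ℝ, 0 < t → G (t • y) = G y) :
    laplaceBeltrami (roundMetric m) f x₀ = Laplacian.laplacian G x₀ := by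
  obtain ⟨L, hL, hσ⟩ := exists_linearIsometry_extChartAt_symm x₀
  set x : EuclideanSpace ℝ (Fin (m + 1)) := x₀.1 with hx
  have hxn : ‖x‖ = 1 := by simp [hx]
  set σ := (extChartAt (𝓡 m) x₀).symm with hσdef
  have hσ0 : σ 0 = x₀ := by
    rw [← extChartAt_self_eq_zero x₀]; exact extChartAt_to_inv x₀
  have hσc : ContDiff ℝ 2 (fun u => (σ u : EuclideanSpace ℝ (Fin (m + 1)))) :=
    coe_extChartAt_symm_contDiff x₀
  have hσt : Filter.Tendsto σ (𝓝 0) (𝓝 x₀) := by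
    have : Continuous σ := continuous_induced_rng.2 hσc.continuous
    simpa [hσ0] using this.tendsto 0
  have hev : (f ∘ σ) =ᶠ[𝓝 0] fun u => G (σ u) := hσt.eventually hfG
  have hGσ : ContDiffAt ℝ 2 (fun u => G (σ u)) 0 := by
    refine ContDiffAt.comp (g := G) 0 ?_ hσc.contDiffAt
    rw [hσ0]; exact hG
  have hfσ : ContDiffAt ℝ 2 (f ∘ σ) 0 := hGσ.congr_of_eventuallyEq hev
  rw [laplaceBeltrami_roundMetric x₀ f hfσ]
  -- In this adapted basis the radial direction contributes nothing, by homogeneity, and each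
  -- remaining vector is matched with one coordinate direction of the chart.
  have hon : Orthonormal ℝ (Fin.cons x (fun i => L (EuclideanSpace.single i 1)) :
      Fin (m + 1) → EuclideanSpace ℝ (Fin (m + 1))) := by
    rw [orthonormal_iff_ite]
    have hL' : ∀ u, inner ℝ (L u) x = 0 := fun u => by rw [real_inner_comm, hL]
    intro i j
    refine Fin.cases ?_ (fun i => ?_) i <;> refine Fin.cases ?_ (fun j => ?_) j
    · simp [hxn]
    · simp [hL, (Fin.succ_ne_zero _).symm]
    · simp [hL', Fin.succ_ne_zero]
    · simp [L.inner_map_map, EuclideanSpace.inner_single_left]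
  let b := (basisOfOrthonormalOfCardEqFinrank hon (by simp)).toOrthonormalBasis (by simpa using hon)
  have hb : ∀ i, b i = (Fin.cons x (fun i => L (EuclideanSpace.single i 1)) :
      Fin (m + 1) → EuclideanSpace ℝ (Fin (m + 1))) i := fun i => by simp [b]
  rw [laplacian_eq_sum_deriv_deriv b hG, Fin.sum_univ_succ]
  simp only [hb, Fin.cons_zero, Fin.cons_succ]
  have hrad : deriv (deriv fun t : ℝ => G (x + t • x)) 0 = 0 := by
    have : (fun t : ℝ => G (x + t • x)) =ᶠ[𝓝 0] fun _ => G x := by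
      filter_upwards [eventually_gt_nhds (show (-1 : ℝ) < 0 by norm_num)] with t ht
      rw [show x + t • x = (1 + t) • x by module]
      exact hhom.self_of_nhds _ (by linarith)
    rw [this.deriv.deriv_eq]
    simp
  rw [hrad, zero_add]
  refine Finset.sum_congr rfl fun i _ => ?_
  rw [fderiv_fderiv_apply_eq_deriv_deriv hfσ]
  set w := L (EuclideanSpace.single i 1)
  have hγ : ContDiffAt ℝ 2 (fun t : ℝ => G (x + t • w)) 0 := by
    refine ContDiffAt.comp (g := G) 0 ?_ (by fun_prop)
    simpa using hG
  have hne : ∀ᶠ t : ℝ in 𝓝 0, 0 < 4 - t ^ 2 := by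
    refine ContinuousAt.eventually_lt (by fun_prop) (by fun_prop) (by norm_num)
  -- The chart sends `t eᵢ` to `(4 - t²)/(t² + 4)` times `x + (4t/(4 - t²)) w`. Homogeneity discards
  -- the positive scalar, which leaves a straight line with parameter `4t/(4 - t²) = t + O(t³)`.
  have hs : ∀ᶠ t : ℝ in 𝓝 0, HasDerivAt (fun t : ℝ => 4 * t / (4 - t ^ 2))
      ((16 + 4 * t ^ 2) / (4 - t ^ 2) ^ 2) t := by
    filter_upwards [hne] with t ht
    have := ((hasDerivAt_id t).const_mul 4).div (((hasDerivAt_id t).pow 2).const_sub 4) ht.ne'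
    convert! this using 1
    simp
    ring
  have hk : HasDerivAt (fun t : ℝ => (16 + 4 * t ^ 2) / (4 - t ^ 2) ^ 2) 0 0 := by
    have h2 := (hasDerivAt_id (0 : ℝ)).pow 2
    have := ((h2.const_mul 4).const_add 16).div ((h2.const_sub 4).pow 2) (by norm_num)
    convert! this using 1
    simp
  rw [← deriv_deriv_comp_of_deriv_eq_one hγ (by simp) hs hk (by norm_num)]
  have hst : Filter.Tendsto (fun t : ℝ => x + (4 * t / (4 - t ^ 2)) • w) (𝓝 0) (𝓝 x) := by
    have h := hs.self_of_nhds.continuousAt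
    have : ContinuousAt (fun t : ℝ => x + (4 * t / (4 - t ^ 2)) • w) 0 := by fun_prop
    simpa [ContinuousAt] using this
  have hlt : Filter.Tendsto (fun t : ℝ => (0 : EuclideanSpace ℝ (Fin m)) + t •
      EuclideanSpace.single i (1 : ℝ)) (𝓝 0) (𝓝 0) := by
    have : Continuous (fun t : ℝ => (0 : EuclideanSpace ℝ (Fin m)) + t • EuclideanSpace.single i
        (1 : ℝ)) := by fun_prop
    simpa using this.tendsto 0
  have hfin : (fun t : ℝ => (f ∘ σ) (0 + t • EuclideanSpace.single i (1 : ℝ))) =ᶠ[𝓝 0]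
      fun t => G (x + (4 * t / (4 - t ^ 2)) • w) := by
    filter_upwards [hne, hst.eventually hhom, hlt.eventually hev] with t ht hh hev
    rw [hev, hσ, zero_add, ← hh ((t ^ 2 + 4)⁻¹ * (4 - t ^ 2)) (by positivity)]
    congr 1
    rw [map_smul, norm_smul]
    simp only [PiLp.norm_single, norm_one, mul_one, Real.norm_eq_abs, sq_abs]
    match_scalars <;> field_simp
  rw [hfin.deriv.deriv_eq]

/-! ### Polynomials along lines, the complex chain rule, and half powers. -/

theorem eval_smul_of_isHomogeneous {σ R : Type*} [CommSemiring R] {p : MvPolynomial σ R} {k : ℕ}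
    (hp : p.IsHomogeneous k) (c : R) (x : σ → R) :
    MvPolynomial.eval (c • x) p = c ^ k * MvPolynomial.eval x p := by
  rw [MvPolynomial.eval_eq, MvPolynomial.eval_eq, Finset.mul_sum]
  refine Finset.sum_congr rfl fun s hs => ?_
  have hs' : ∑ i ∈ s.support, s i = k := by
    rw [← Finsupp.degree_apply, Finsupp.degree_eq_weight_one]
    exact hp (MvPolynomial.mem_support_iff.1 hs)
  simp only [Pi.smul_apply, smul_eq_mul, mul_pow, Finset.prod_mul_distrib,
      Finset.prod_pow_eq_pow_sum, hs']
  ring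

theorem hasDerivAt_eval_line {σ : Type*} [DecidableEq σ] (p : MvPolynomial σ ℂ) (x : σ → ℂ)
    (k : σ) (t : ℝ) :
    HasDerivAt (fun t : ℝ => MvPolynomial.eval (x + t • (Pi.single k (1 : ℂ) : σ → ℂ)) p)
      (MvPolynomial.eval (x + t • (Pi.single k (1 : ℂ) : σ → ℂ)) (MvPolynomial.pderiv k p)) t := by
  induction p using MvPolynomial.induction_on with
  | C a => simpa using hasDerivAt_const t a
  | add p q hp hq => simpa using! hp.add hq
  | mul_X p i hp =>
    have hi : HasDerivAt (fun t : ℝ => (x + t • (Pi.single k (1 : ℂ) : σ → ℂ)) i)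
        ((Pi.single k (1 : ℂ) : σ → ℂ) i) t := by
      have := ((hasDerivAt_id t).smul_const ((Pi.single k (1 : ℂ) : σ → ℂ) i)).const_add (x i)
      simpa using this
    have := hp.mul hi
    simp only [map_mul, MvPolynomial.eval_X, Derivation.leibniz, MvPolynomial.pderiv_X, map_add,
        smul_eq_mul]
    convert! this using 1
    have : MvPolynomial.eval (x + t • (Pi.single k (1 : ℂ) : σ → ℂ))
        ((Pi.single k 1 : σ → MvPolynomial σ ℂ) i) = (Pi.single k (1 : ℂ) : σ → ℂ) i := by
      by_cases h : i = k
      · subst h; simp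
      · simp [h]
    rw [this]
    ring

/-- Because `a` is holomorphic, the velocity enters as the complex square `π'²`, not as `|π'|²`.
Sums of such squares can vanish, which is how horizontal conformality and `1 + i² = 0` are used
later. -/
theorem deriv_deriv_comp_analyticAt {a : ℂ → ℂ} {π π' : ℝ → ℂ} {π'' : ℂ} (ha : AnalyticAt ℂ a (π 0))
    (hπ : ∀ t, HasDerivAt π (π' t) t) (hπ' : HasDerivAt π' π'' 0) :
    deriv (deriv fun t => a (π t)) 0 = deriv (deriv a) (π 0) * (π' 0 * π' 0) + deriv a (π 0) * π''
        := by
  have hev : ∀ᶠ t in 𝓝 0, deriv (fun t => a (π t)) t = deriv a (π t) * π' t := by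
    filter_upwards [(hπ 0).continuousAt.tendsto.eventually ha.eventually_analyticAt] with t ht
    exact (ht.differentiableAt.hasDerivAt.comp_of_eq t (hπ t) rfl).deriv
  rw [Filter.EventuallyEq.deriv_eq hev]
  have h1 := ha.deriv.differentiableAt.hasDerivAt.comp_of_eq (0 : ℝ) (hπ 0) rfl
  refine (h1.mul hπ').deriv.trans ?_
  simp only [Function.comp]
  ring

theorem analyticAt_halfPow (d : ℕ) {w : ℂ} (hw : Odd d → w ∈ Complex.slitPlane) :
    AnalyticAt ℂ (halfPow d) w := by
  by_cases hd : Even d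
  · have : halfPow d = fun w => w ^ (d / 2) := funext fun w => by simp [halfPow, hd]
    rw [this]
    fun_prop
  · have : halfPow d = fun w => (w ^ (1 / 2 : ℂ)) ^ d := funext fun w => by simp [halfPow, hd]
    rw [this]
    exact (analyticAt_id.cpow analyticAt_const (hw (Nat.not_even_iff_odd.1 hd))).pow d

theorem halfPow_sq_mul (d : ℕ) {t : ℝ} (ht : 0 < t) {w : ℂ} (hw : Odd d → w ∈ Complex.slitPlane) :
    halfPow d ((t : ℂ) ^ 2 * w) = (t : ℂ) ^ d * halfPow d w := by
  by_cases hd : Even d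
  · simp only [halfPow, hd, if_true, mul_pow, ← pow_mul, Nat.mul_div_cancel' hd.two_dvd]
  · have hw0 : w ≠ 0 := Complex.slitPlane_ne_zero (hw (Nat.not_even_iff_odd.1 hd))
    have ht0 : (t : ℂ) ≠ 0 := by exact_mod_cast ht.ne'
    simp only [halfPow, hd, if_false, ← mul_pow]
    congr 1
    -- Multiplication by a positive real leaves the argument unchanged, so the principal logarithm
    -- is additive here and the principal root of `t² w` is `t` times that of `w`.
    rw [Complex.cpow_def_of_ne_zero (mul_ne_zero (pow_ne_zero 2 ht0) hw0),
        Complex.cpow_def_of_ne_zero hw0,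
      ← Complex.ofReal_pow, Complex.log_ofReal_mul (by positivity) hw0, add_mul, Complex.exp_add,
      Real.log_pow]
    congr 1
    rw [show ((((2 : ℕ) : ℝ) * Real.log t : ℝ) : ℂ) * (1 / 2) = (Real.log t : ℂ) by push_cast; ring,
      ← Complex.ofReal_exp, Real.exp_log ht]

/-! ### The cone `hatDomain`, the scaling and analyticity of `hatPhi`, and descent to the sphere. -/

section
variable {n d : ℕ} {p : MvPolynomial (Fin 3) ℂ} {P Q : MvPolynomial (Fin n) ℂ}

theorem realPart_smul (t : ℝ) (x : EuclideanSpace ℝ (Fin (2 * n + 2 + 1))) :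
    realPart n (t • x) = (t : ℂ) • realPart n x := by
  ext k; simp [realPart]

theorem complexPart_smul (t : ℝ) (x : EuclideanSpace ℝ (Fin (2 * n + 2 + 1))) :
    complexPart n (t • x) = (t : ℂ) • complexPart n x := by
  ext k; simp [complexPart]; ring

theorem smul_mem_hatDomain (hp : p.IsHomogeneous 2) (hQ : Q.IsHomogeneous d) {t : ℝ} (ht : 0 < t)
    {x : EuclideanSpace ℝ (Fin (2 * n + 2 + 1))} (hx : x ∈ hatDomain n d p Q) :
    t • x ∈ hatDomain n d p Q := by
  have ht0 : (t : ℂ) ≠ 0 := by exact_mod_cast ht.ne'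
  refine ⟨?_, fun hd => ?_⟩
  · rw [complexPart_smul, eval_smul_of_isHomogeneous hQ]
    exact mul_ne_zero (pow_ne_zero d ht0) hx.1
  · rw [realPart_smul, eval_smul_of_isHomogeneous hp, ← Complex.ofReal_pow]
    have := hx.2 hd
    have h2 : 0 < t ^ 2 := by positivity
    rw [Complex.mem_slitPlane_iff] at this ⊢
    rw [Complex.re_ofReal_mul, Complex.im_ofReal_mul]
    exact this.imp (mul_pos h2) (mul_ne_zero h2.ne')

theorem hatPhi_smul (hp : p.IsHomogeneous 2) (hP : P.IsHomogeneous d) (hQ : Q.IsHomogeneous d)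
    {t : ℝ} (ht : 0 < t)
    {x : EuclideanSpace ℝ (Fin (2 * n + 2 + 1))} (hx : x ∈ hatDomain n d p Q) :
    hatPhi n d p P Q (t • x) = hatPhi n d p P Q x := by
  have ht0 : (t : ℂ) ^ d ≠ 0 := pow_ne_zero d (by exact_mod_cast ht.ne')
  simp only [hatPhi, complexPart_smul, realPart_smul, eval_smul_of_isHomogeneous hQ,
    eval_smul_of_isHomogeneous hP, eval_smul_of_isHomogeneous hp, halfPow_sq_mul d ht hx.2]
  rw [← mul_add, mul_div_mul_left _ _ ht0]

theorem analyticAt_eval_complexPart (R : MvPolynomial (Fin n) ℂ)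
    (x : EuclideanSpace ℝ (Fin (2 * n + 2 + 1))) :
    AnalyticAt ℝ (fun x => MvPolynomial.eval (complexPart n x) R) x := by
  have hc : ∀ k, AnalyticAt ℝ (fun x => complexPart n x k) x := fun k => by
    have h (j) : AnalyticAt ℝ (fun x : EuclideanSpace ℝ (Fin (2 * n + 2 + 1)) => (x j : ℂ)) x :=
      (Complex.ofRealCLM.comp (EuclideanSpace.proj (𝕜 := ℝ) j)).analyticAt x
    exact (h _).add ((h _).mul analyticAt_const)
  exact AnalyticAt.aeval_mvPolynomial hc R

theorem analyticAt_eval_realPart (R : MvPolynomial (Fin 3) ℂ)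
    (x : EuclideanSpace ℝ (Fin (2 * n + 2 + 1))) :
    AnalyticAt ℝ (fun x => MvPolynomial.eval (realPart n x) R) x :=
  AnalyticAt.aeval_mvPolynomial (fun k : Fin 3 =>
    (Complex.ofRealCLM.comp (EuclideanSpace.proj (𝕜 := ℝ)
        (⟨k, by omega⟩ : Fin (2 * n + 2 + 1)))).analyticAt x) R

theorem isOpen_hatDomain : IsOpen (hatDomain n d p Q) := by
  have h1 : Continuous fun x => MvPolynomial.eval (complexPart n x) Q :=
    continuous_iff_continuousAt.2 fun x => (analyticAt_eval_complexPart Q x).continuousAt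
  have h2 : Continuous fun x => MvPolynomial.eval (realPart n x) p :=
    continuous_iff_continuousAt.2 fun x => (analyticAt_eval_realPart p x).continuousAt
  have h3 : IsOpen {x | Odd d → MvPolynomial.eval (realPart n x) p ∈ Complex.slitPlane} := by
    by_cases hd : Odd d
    · simpa only [hd, forall_const] using! Complex.isOpen_slitPlane.preimage h2
    · simp only [hd, false_imp_iff, Set.ofPred_true, isOpen_univ]
  exact (isOpen_ne_fun h1 continuous_const).inter h3

theorem analyticAt_hatPhi {x : EuclideanSpace ℝ (Fin (2 * n + 2 + 1))}
    (hx : x ∈ hatDomain n d p Q) :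
    AnalyticAt ℝ (hatPhi n d p P Q) x :=
  (((analyticAt_halfPow d hx.2).restrictScalars.comp_of_eq (analyticAt_eval_realPart p x) rfl).add
    (analyticAt_eval_complexPart P x)).div (analyticAt_eval_complexPart Q x) hx.1

theorem zero_notMem_hatDomain (hd : 0 < d) (hQ : Q.IsHomogeneous d) :
    (0 : EuclideanSpace ℝ (Fin (2 * n + 2 + 1))) ∉ hatDomain n d p Q := by
  intro h
  apply h.1
  have h0 : complexPart n (0 : EuclideanSpace ℝ (Fin (2 * n + 2 + 1))) = (0 : ℂ) • 0 := by
    ext k; simp [complexPart]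
  rw [h0, eval_smul_of_isHomogeneous hQ, zero_pow hd.ne', zero_mul]

theorem coe_radialProj {m : ℕ} (x : {x : EuclideanSpace ℝ (Fin (m + 1)) // x ≠ 0}) :
    (radialProj m x : EuclideanSpace ℝ (Fin (m + 1))) = ‖x.1‖⁻¹ • x.1 := rfl

theorem radialProj_coe {m : ℕ} (y : Sphere m) (hy : y.1 ≠ 0) : radialProj m ⟨y.1, hy⟩ = y := by
  apply Subtype.ext
  rw [coe_radialProj, norm_eq_of_mem_sphere, inv_one, one_smul]

/-- A set stable under positive scaling projects radially onto its trace on the sphere. Openness and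
pointwise statements can then be checked in the ambient space. -/
theorem sphereDomain_eq (hd : 0 < d) (hp : p.IsHomogeneous 2) (hQ : Q.IsHomogeneous d) :
    sphereDomain n d p Q = Subtype.val ⁻¹' hatDomain n d p Q := by
  ext y
  rw [Set.mem_preimage]
  constructor
  · rintro ⟨x, hx, rfl⟩
    rw [coe_radialProj]
    exact smul_mem_hatDomain hp hQ (inv_pos.2 (norm_pos_iff.2 x.2)) hx
  · intro hy
    exact ⟨⟨y.1, ne_of_mem_of_not_mem hy (zero_notMem_hatDomain hd hQ)⟩, hy, radialProj_coe y _⟩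

/-- The sphere is fixed by the radial projection, and `hatPhi` is constant on rays of the cone. This
gives existence of the induced map and its uniqueness on the domain. -/
theorem isInducedMap_iff (hd : 0 < d) (hp : p.IsHomogeneous 2) (hP : P.IsHomogeneous d)
    (hQ : Q.IsHomogeneous d)
    {Φ : Sphere (2 * n + 2) → ℂ} : IsInducedMap n d p P Q Φ ↔
      ∀ y : Sphere (2 * n + 2), y.1 ∈ hatDomain n d p Q → Φ y = hatPhi n d p P Q y.1 := by
  constructor
  · intro h y hy
    have h' := h ⟨y.1, ne_of_mem_of_not_mem hy (zero_notMem_hatDomain hd hQ)⟩ hy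
    rwa [radialProj_coe] at h'
  · intro h x hx
    have ht := inv_pos.2 (norm_pos_iff.2 x.2)
    refine (h (radialProj _ x) ?_).trans ?_
    · rw [coe_radialProj]
      exact smul_mem_hatDomain hp hQ ht hx
    · rw [coe_radialProj]
      exact hatPhi_smul hp hP hQ ht hx

theorem sum_fin_eq_sum_realPart_add_sum_complexPart {A : Type*} [AddCommMonoid A] (n : ℕ)
    (a : Fin (2 * n + 2 + 1) → A) :
    ∑ i, a i = ∑ k : Fin 3, a ⟨k, by omega⟩ +
      ∑ k : Fin n, (a ⟨2 * k + 3, by omega⟩ + a ⟨2 * k + 4, by omega⟩) := by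
  have key (b : ℕ → A) (n : ℕ) : ∑ i ∈ Finset.range (2 * n + 2 + 1), b i = ∑ k ∈ Finset.range 3, b
      k +
      ∑ k ∈ Finset.range n, (b (2 * k + 3) + b (2 * k + 4)) := by
    induction n with
    | zero => simp
    | succ n ih =>
      rw [show 2 * (n + 1) + 2 + 1 = (2 * n + 2 + 1) + 1 + 1 by ring, Finset.sum_range_succ,
          Finset.sum_range_succ, ih,
        Finset.sum_range_succ _ n]
      simp only [add_assoc]
  -- The value `0` only extends `a` to all naturals; every index occurring in the sums is in range.
  have h := key (fun i => if h : i < 2 * n + 2 + 1 then a ⟨i, h⟩ else 0) n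
  rw [Finset.sum_range, Finset.sum_range, Finset.sum_range] at h
  simp only [Fin.is_lt, dif_pos] at h
  rw [h]
  congr 1
  exact Finset.sum_congr rfl fun k _ => congrArg₂ _ (dif_pos (by omega)) (dif_pos (by omega))

end

/-! ### Harmonicity on the Euclidean cone and the harmonic morphism property. -/

section
variable {n d : ℕ} {p : MvPolynomial (Fin 3) ℂ} {P Q : MvPolynomial (Fin n) ℂ}

theorem realPart_add_smul_single_real (x : EuclideanSpace ℝ (Fin (2 * n + 2 + 1))) (t : ℝ)
    (k : Fin 3) :
    realPart n (x + t • EuclideanSpace.single ⟨k, by omega⟩ 1) =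
      realPart n x + t • (Pi.single k (1 : ℂ) : Fin 3 → ℂ) := by
  ext j
  by_cases h : j = k
  · subst h; simp [realPart]
  · simp [realPart, h, Fin.val_inj]

theorem complexPart_add_smul_single_real (x : EuclideanSpace ℝ (Fin (2 * n + 2 + 1))) (t : ℝ)
    (k : Fin 3) :
    complexPart n (x + t • EuclideanSpace.single ⟨k, by omega⟩ 1) = complexPart n x := by
  ext j
  have h1 : ¬ 2 * (j : ℕ) + 3 = k := by omega
  have h2 : ¬ 2 * (j : ℕ) + 4 = k := by omega
  simp [complexPart, h1, h2]

theorem realPart_add_smul_single_complex (x : EuclideanSpace ℝ (Fin (2 * n + 2 + 1))) (t : ℝ)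
    (i : Fin (2 * n + 2 + 1)) (hi : 3 ≤ (i : ℕ)) :
    realPart n (x + t • EuclideanSpace.single i 1) = realPart n x := by
  ext j
  have h1 : ¬ (⟨j, by omega⟩ : Fin (2 * n + 2 + 1)) = i := by rw [Fin.ext_iff]; dsimp only; omega
  simp [realPart, h1]

/-- The redundant factor `1` gives this the same shape as the imaginary direction, so that one
computation with a direction `c` covers both `c = 1` and `c = I`. -/
theorem complexPart_add_smul_single_re (x : EuclideanSpace ℝ (Fin (2 * n + 2 + 1))) (t : ℝ)
    (k : Fin n) :
    complexPart n (x + t • EuclideanSpace.single ⟨2 * k + 3, by omega⟩ 1) =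
      complexPart n x + (t * 1 : ℂ) • (Pi.single k (1 : ℂ) : Fin n → ℂ) := by
  ext j
  have h2 : ¬ 2 * (j : ℕ) + 4 = 2 * k + 3 := by omega
  by_cases h : j = k
  · subst h; simp [complexPart]; ring
  · simp [complexPart, h, h2, Fin.val_inj]

theorem complexPart_add_smul_single_im (x : EuclideanSpace ℝ (Fin (2 * n + 2 + 1))) (t : ℝ)
    (k : Fin n) :
    complexPart n (x + t • EuclideanSpace.single ⟨2 * k + 4, by omega⟩ 1) =
      complexPart n x + (t * Complex.I : ℂ) • (Pi.single k (1 : ℂ) : Fin n → ℂ) := by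
  ext j
  have h2 : ¬ 2 * (j : ℕ) = 2 * k + 1 := by omega
  by_cases h : j = k
  · subst h; simp [complexPart]; ring
  · simp [complexPart, h, h2, Fin.val_inj]

theorem laplacian_comp_hatPhi_eq_zero (hp : IsConformalHarmonicQuadratic p)
    {x : EuclideanSpace ℝ (Fin (2 * n + 2 + 1))} (hx : x ∈ hatDomain n d p Q) {F : ℂ → ℂ}
    (hF : AnalyticAt ℂ F (hatPhi n d p P Q x)) :
    Laplacian.laplacian (fun y => F (hatPhi n d p P Q y)) x = 0 := by
  have hK : AnalyticAt ℝ (fun y => F (hatPhi n d p P Q y)) x :=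
    hF.restrictScalars.comp_of_eq (analyticAt_hatPhi hx) rfl
  rw [laplacian_eq_sum_deriv_deriv (EuclideanSpace.basisFun _ ℝ) hK.contDiffAt,
    sum_fin_eq_sum_realPart_add_sum_complexPart]
  simp only [EuclideanSpace.basisFun_apply]
  set X := realPart n x
  set z := complexPart n x
  have h1 : AnalyticAt ℂ (fun w => F ((halfPow d w + MvPolynomial.eval z P) / MvPolynomial.eval z
      Q))
      (MvPolynomial.eval X p) :=
    AnalyticAt.comp_of_eq (f := fun w => (halfPow d w + MvPolynomial.eval z P) / MvPolynomial.eval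
        z Q) hF
      (((analyticAt_halfPow d hx.2).add analyticAt_const).div analyticAt_const hx.1) rfl
  -- With `z` frozen, the function is a fixed holomorphic function of `p`. Its two derivatives do
  -- not depend on `k`, so they factor out of the sum over `k`.
  have hreal : ∀ k : Fin 3, deriv (deriv fun t : ℝ =>
      F (hatPhi n d p P Q (x + t • EuclideanSpace.single ⟨k, by omega⟩ 1))) 0 =
      deriv (deriv fun w => F ((halfPow d w + MvPolynomial.eval z P) / MvPolynomial.eval z Q))
          (MvPolynomial.eval X p) *
        MvPolynomial.eval X (MvPolynomial.pderiv k p * MvPolynomial.pderiv k p) +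
      deriv (fun w => F ((halfPow d w + MvPolynomial.eval z P) / MvPolynomial.eval z Q))
          (MvPolynomial.eval X p) *
        MvPolynomial.eval X (MvPolynomial.pderiv k (MvPolynomial.pderiv k p)) := by
    intro k
    simp only [hatPhi, realPart_add_smul_single_real, complexPart_add_smul_single_real]
    have h0 : X + (0 : ℝ) • (Pi.single k (1 : ℂ) : Fin 3 → ℂ) = X := by rw [zero_smul, add_zero]
    have := deriv_deriv_comp_analyticAt (π := fun t => MvPolynomial.eval
        (X + t • (Pi.single k (1 : ℂ) : Fin 3 → ℂ)) p)
      (by rw [h0]; exact h1) (hasDerivAt_eval_line p X k)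
      (hasDerivAt_eval_line (MvPolynomial.pderiv k p) X k 0)
    simpa only [h0, map_mul] using this
  -- With `x` and the other complex coordinates frozen, the function is holomorphic in `ζ`, even
  -- though `p` is raised to a half power: that term is now a constant.
  have hcomplex : ∀ (k : Fin n) (c : ℂ),
      deriv (deriv fun t : ℝ =>
        F ((halfPow d (MvPolynomial.eval X p) + MvPolynomial.eval
            (z + (t * c : ℂ) • (Pi.single k (1 : ℂ) : Fin n → ℂ)) P) /
          MvPolynomial.eval (z + (t * c : ℂ) • (Pi.single k (1 : ℂ) : Fin n → ℂ)) Q)) 0 =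
      deriv (deriv fun ζ : ℂ =>
        F ((halfPow d (MvPolynomial.eval X p) + MvPolynomial.eval
            (z + ζ • (Pi.single k (1 : ℂ) : Fin n → ℂ)) P) /
          MvPolynomial.eval (z + ζ • (Pi.single k (1 : ℂ) : Fin n → ℂ)) Q)) 0 * (c * c) := by
    intro k c
    have h0 : z + (0 : ℂ) • (Pi.single k (1 : ℂ) : Fin n → ℂ) = z := by rw [zero_smul, add_zero]
    have he (R : MvPolynomial (Fin n) ℂ) : AnalyticAt ℂ
        (fun ζ : ℂ => MvPolynomial.eval (z + ζ • (Pi.single k (1 : ℂ) : Fin n → ℂ)) R) 0 :=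
      AnalyticAt.aeval_mvPolynomial (fun i => by simp only
          [Pi.add_apply, Pi.smul_apply, smul_eq_mul]; fun_prop) R
    have hβ : AnalyticAt ℂ (fun ζ : ℂ =>
        F ((halfPow d (MvPolynomial.eval X p) + MvPolynomial.eval
            (z + ζ • (Pi.single k (1 : ℂ) : Fin n → ℂ)) P) /
          MvPolynomial.eval (z + ζ • (Pi.single k (1 : ℂ) : Fin n → ℂ)) Q)) 0 :=
      hF.comp_of_eq ((analyticAt_const.add (he P)).div (he Q) (by rw [h0]; exact hx.1))
          (by simp only [h0]; rfl)
    have hc (t : ℝ) : HasDerivAt (fun t : ℝ => (t * c : ℂ)) c t := by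
      simpa using (Complex.ofRealCLM.hasDerivAt (x := t)).mul_const c
    have := deriv_deriv_comp_analyticAt (π := fun t : ℝ => (t * c : ℂ)) (by simpa using hβ) hc
        (hasDerivAt_const 0 c)
    simpa using this
  have hre : ∀ k : Fin n, deriv (deriv fun t : ℝ =>
        F (hatPhi n d p P Q (x + t • EuclideanSpace.single ⟨2 * k + 3, by omega⟩ 1))) 0 +
      deriv (deriv fun t : ℝ =>
        F (hatPhi n d p P Q (x + t • EuclideanSpace.single ⟨2 * k + 4, by omega⟩ 1))) 0 = 0 := by
    intro k
    simp only [hatPhi, complexPart_add_smul_single_re, complexPart_add_smul_single_im]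
    simp only [realPart_add_smul_single_complex x _ ⟨2 * k + 3, by omega⟩ (by simp),
      realPart_add_smul_single_complex x _ ⟨2 * k + 4, by omega⟩ (by simp)]
    rw [hcomplex k 1, hcomplex k Complex.I, Complex.I_mul_I]
    ring
  simp only [hre, hreal, Finset.sum_const_zero, add_zero, Finset.sum_add_distrib, ←
      Finset.mul_sum, ← map_sum,
    hp.harmonic, hp.conformal, map_zero, mul_zero]

theorem laplacian_comp_hatPhi_eq_zero_of_harmonicOnNhd (hp : IsConformalHarmonicQuadratic p)
    {x : EuclideanSpace ℝ (Fin (2 * n + 2 + 1))} (hx : x ∈ hatDomain n d p Q) {W : Set ℂ}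
        {f : ℂ → ℝ}
    (hW : IsOpen W) (hf : InnerProductSpace.HarmonicOnNhd f W) (hxW : hatPhi n d p P Q x ∈ W) :
    Laplacian.laplacian (fun y => f (hatPhi n d p P Q y)) x = 0 := by
  -- `W` need not be simply connected, so a holomorphic `F` with real part `f` is taken only on a
  -- ball around the value.
  obtain ⟨R, hR, hball⟩ := Metric.isOpen_iff.1 hW _ hxW
  obtain ⟨F, hF, hFf⟩ := (hf.mono hball).exists_analyticOnNhd_ball_re_eq
  have hFx := hF _ (Metric.mem_ball_self hR)
  have hK : AnalyticAt ℝ (fun y => F (hatPhi n d p P Q y)) x :=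
    hFx.restrictScalars.comp_of_eq (analyticAt_hatPhi hx) rfl
  have hev : (fun y => f (hatPhi n d p P Q y)) =ᶠ[𝓝 x] Complex.reCLM ∘ fun y => F
      (hatPhi n d p P Q y) := by
    filter_upwards [(analyticAt_hatPhi hx).continuousAt.tendsto.eventually
        (Metric.ball_mem_nhds _ hR)] with y hy
    exact (hFf hy).symm
  rw [(InnerProductSpace.laplacian_congr_nhds hev).eq_of_nhds,
    (hK.contDiffAt (n := 2)).laplacian_CLM_comp_left, Function.comp_apply,
    laplacian_comp_hatPhi_eq_zero hp hx hFx, map_zero]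

theorem isHarmonicMorphismOn_sphereDomain (hd : 0 < d) (hp : IsConformalHarmonicQuadratic p)
    (hP : P.IsHomogeneous d) (hQ : Q.IsHomogeneous d) {Φ : Sphere (2 * n + 2) → ℂ}
    (hΦ : IsInducedMap n d p P Q Φ) :
    IsHarmonicMorphismOn (roundMetric (2 * n + 2)) Φ (sphereDomain n d p Q) := by
  have := Fact.mk (@finrank_euclideanSpace_fin ℝ _ (2 * n + 2 + 1))
  rw [isInducedMap_iff hd hp.homogeneous hP hQ] at hΦ
  rw [sphereDomain_eq hd hp.homogeneous hQ]
  have hcoe : ContMDiff (𝓡 (2 * n + 2)) 𝓘(ℝ, EuclideanSpace ℝ (Fin (2 * n + 2 + 1))) ∞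
    (Subtype.val : Sphere (2 * n + 2) → _) := contMDiff_coe_sphere
  have hΦs : ContMDiffOn (𝓡 (2 * n + 2)) 𝓘(ℝ, ℂ) ∞ Φ (Subtype.val ⁻¹' hatDomain n d p Q) := by
    have : ContMDiffOn (𝓡 (2 * n + 2)) 𝓘(ℝ, ℂ) ∞
        (fun y : Sphere (2 * n + 2) => hatPhi n d p P Q y.1)
        (Subtype.val ⁻¹' hatDomain n d p Q) := fun y hy =>
      ((analyticAt_hatPhi hy).contDiffAt.contMDiffAt.comp y hcoe.contMDiffAt).contMDiffWithinAt
    exact this.congr hΦ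
  refine ⟨hΦs, fun W f hW hf => ⟨?_, fun y hy => ?_⟩⟩
  · exact (hf.contDiffOn.contMDiffOn).comp ((hΦs.of_le
        (WithTop.coe_le_coe.2 (le_top : (2 : ℕ∞) ≤ ⊤))).mono Set.inter_subset_left) fun y hy => hy.2
  · have hy1 : y.1 ∈ hatDomain n d p Q := hy.1
    have hyW : hatPhi n d p P Q y.1 ∈ W := by rw [← hΦ y hy1]; exact hy.2
    -- The degree-zero extension of `f ∘ Φ` is `f ∘ hatPhi`; it need only be homogeneous and agree
    -- with `f ∘ Φ` near `y`.
    rw [laplaceBeltrami_roundMetric_eq_laplacian y (f ∘ Φ) (fun x => f (hatPhi n d p P Q x))]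
    · exact laplacian_comp_hatPhi_eq_zero_of_harmonicOnNhd hp hy1 hW hf hyW
    · exact ContDiffAt.comp (g := f) _ (hf _ hyW).1 (analyticAt_hatPhi hy1).contDiffAt
    · filter_upwards [(isOpen_hatDomain.preimage continuous_subtype_val).mem_nhds hy1] with z hz
      exact congrArg f (hΦ z hz)
    · filter_upwards [isOpen_hatDomain.mem_nhds hy1] with z hz t ht
      rw [hatPhi_smul hp.homogeneous hP hQ ht hz]

end
end SphereHM

theorem mainTheorem3 (n d : ℕ) (hn : 0 < n) (hd : 0 < d)
    (p : MvPolynomial (Fin 3) ℂ) (hp : SphereHM.IsConformalHarmonicQuadratic p)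
    (P Q : MvPolynomial (Fin n) ℂ) (hP : P.IsHomogeneous d) (hQ : Q.IsHomogeneous d) :
    (0 : EuclideanSpace ℝ (Fin (2 * n + 2 + 1))) ∉ SphereHM.hatDomain n d p Q ∧
    (∀ t : ℝ, 0 < t → ∀ x ∈ SphereHM.hatDomain n d p Q,
      t • x ∈ SphereHM.hatDomain n d p Q ∧
        SphereHM.hatPhi n d p P Q (t • x) = SphereHM.hatPhi n d p P Q x) ∧
    IsOpen (SphereHM.sphereDomain n d p Q) ∧
    (∃ Φ : SphereHM.Sphere (2 * n + 2) → ℂ, SphereHM.IsInducedMap n d p P Q Φ) ∧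
    ∀ Φ : SphereHM.Sphere (2 * n + 2) → ℂ, SphereHM.IsInducedMap n d p P Q Φ →
      SphereHM.IsHarmonicMorphismOn (SphereHM.roundMetric (2 * n + 2)) Φ
        (SphereHM.sphereDomain n d p Q) := by
  refine ⟨SphereHM.zero_notMem_hatDomain hd hQ, fun t ht x hx =>
    ⟨SphereHM.smul_mem_hatDomain hp.homogeneous hQ ht hx,
      SphereHM.hatPhi_smul hp.homogeneous hP hQ ht hx⟩, ?_, ?_, fun Φ hΦ =>
    SphereHM.isHarmonicMorphismOn_sphereDomain hd hp hP hQ hΦ⟩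
  · rw [SphereHM.sphereDomain_eq hd hp.homogeneous hQ]
    exact SphereHM.isOpen_hatDomain.preimage continuous_subtype_val
  · exact ⟨fun y => SphereHM.hatPhi n d p P Q y.1,
      (SphereHM.isInducedMap_iff hd hp.homogeneous hP hQ).2 fun _ _ => rfl⟩
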